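/- **Proposition (Converse One-Shot Entanglement Consumption).** All systems are finite-dimensional, $|X|$ is the dimension of the system $X$, and $\log$ is to base $2$. *Entropies.* For positive semidefinite operators $\rho,\sigma$ with trace at most one (subnormalized states) on the same system, let $\bar F(\rho,\sigma)=\|\sqrt\rho\sqrt\sigma\|_1+\sqrt{(1-\mathrm{Tr}\,\rho)(1-\mathrm{Tr}\,\sigma)}$, where $\|M\|_1=\mathrm{Tr}\sqrt{MM^\dagger}$, and let $P(\rho,\sigma)=\sqrt{1-\bar F(\rho,\sigma)^2}$ be the purified distance. Let $H_{\min}(X)_\rho=-\inf\{\lambda\in\mathbb R: 2^\lambda I^X\ge\rho^X\}$ and, for $\epsilon\ge 0$, let $H_{\min}^{\epsilon}(X)_\rho=\sup_{\bar\rho}H_{\min}(X)_{\bar\rho}$, where the supremum is over all subnormalized states $\bar\rho$ on $X$ with $P(\rho^X,\bar\rho)\le\epsilon$. *Protocols.* A one-way ebit-assisted protocol $\Pi$ on systems $A,C$ (Alice) and $B$ (Bob) consists of the following. Alice and Bob share a maximally entangled state $\Phi_{1}^{T_A^{in}T_B^{in}}$ with $|T_A^{in}|=|T_B^{in}|$.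 Alice applies a completely positive trace-preserving map $ACT_A^{in}\to AT_A^{out}Q$ and sends $Q$ to Bob. Bob applies a completely positive trace-preserving map $QBT_B^{in}\to BC'T_B^{out}$, where $C'$ is a copy of $C$ and $|T_A^{out}|=|T_B^{out}|$. All dimensions are arbitrary positive integers. Its quantum communication cost is $q(\Pi)=\log|Q|$ and its net entanglement consumption is $e(\Pi)=\log|T_A^{in}|-\log|T_A^{out}|$. For a pure state $\rho^{ABCR}$ with marginal $\rho^{ABC}$, it is a quantum state redistribution of $\rho^{ABC}$ with error $\epsilon$ if $$P\big(\Pi(\Phi_1^{T_A^{in}T_B^{in}}\otimes\rho^{ABCR}),\ \Phi_2^{T_A^{out}T_B^{out}}\otimes\rho^{ABC'R}\big)\le\epsilon,$$ where $\Phi_2$ is the maximally entangled state, $\Pi$ acts as the identity on $R$, and $\rho^{ABC'R}$ is $\rho^{ABCR}$ with $C$ relabelled as $C'$. *Statement.* Let $\epsilon_1\in(0,1)$ and $\epsilon_2\in(0,1-\epsilon_1)$, and let $\rho^{ABC}$ be a normalized state with purification $\rho^{ABCR}$. Then for every one-way ebit-assisted quantum state redistribution $\Pi$ of $\rho^{ABC}$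 with error $\epsilon_1$, the two smooth min-entropies below are finite and $$e(\Pi)+q(\Pi)\ \ge\ H_{\min}^{\epsilon_2}(BC)_\rho-H_{\min}^{\epsilon_1+\epsilon_2}(B)_\rho .$$ -/

import Mathlib

noncomputable section

namespace QSR

open scoped Kronecker MatrixOrder ComplexOrder

/-! Finite-dimensional quantum systems are given by finite index types of orthonormal bases;
operators on a system are complex square matrices; tensor products are products of index types. -/

/-- Subnormalized states: positive semidefinite with trace at most one. -/
def IsSubstate {a : Type*} [Fintype a] (ρ : Matrix a a ℂ) : Prop :=
  ρ.PosSemidef ∧ ρ.trace.re ≤ 1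

/-- Normalized states: positive semidefinite with trace one. -/
def IsState {a : Type*} [Fintype a] (ρ : Matrix a a ℂ) : Prop :=
  ρ.PosSemidef ∧ ρ.trace = 1

/-- The operator `|ψ⟩⟨ψ|`. -/
def pureState {a : Type*} (ψ : a → ℂ) : Matrix a a ℂ :=
  Matrix.vecMulVec ψ (star ψ)

/-- Partial trace over the first tensor factor. -/
def trFst {a b : Type*} [Fintype a] (M : Matrix (a × b) (a × b) ℂ) : Matrix b b ℂ :=
  fun i j => ∑ x, M (x, i) (x, j)

/-- Partial trace over the second tensor factor. -/
def trSnd {a b : Type*} [Fintype b] (M : Matrix (a × b) (a × b) ℂ) : Matrix a a ℂ :=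
  fun i j => ∑ x, M (i, x) (j, x)

/-- The set of real `t` with `2 ^ t • σ ≥ ρ` in the Loewner order. -/
def dMaxSet {a : Type*} (ρ σ : Matrix a a ℂ) : Set ℝ :=
  {t : ℝ | ρ ≤ ((2 : ℝ) ^ t) • σ}

/-- Max-relative entropy `D_max(ρ ‖ σ) = inf {t ∈ ℝ : 2 ^ t σ ≥ ρ}`, with values in `[-∞, ∞]`. -/
def dMax {a : Type*} (ρ σ : Matrix a a ℂ) : EReal :=
  sInf ((fun t : ℝ => (t : EReal)) '' dMaxSet ρ σ)

/-- Conditional min-entropy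
`H_min(A|B)_ρ = - inf_σ D_max(ρ ‖ I ⊗ σ)`, the infimum over normalized states `σ` of `B`. -/
def condMinEntropy {a b : Type*} [DecidableEq a] [Fintype b]
    (ρ : Matrix (a × b) (a × b) ℂ) : EReal :=
  -sInf {x : EReal | ∃ σ : Matrix b b ℂ, IsState σ ∧ x = dMax ρ ((1 : Matrix a a ℂ) ⊗ₖ σ)}

/-- Min-entropy `H_min(A)_ρ = - D_max(ρ ‖ I)`; this is the conditional min-entropy given a
trivial system, see `condMinEntropy_trivial`. -/
def minEntropy {a : Type*} [DecidableEq a] (ρ : Matrix a a ℂ) : EReal :=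
  -dMax ρ 1

/-- The trace norm `‖M‖₁ = Tr √(M M†)`. -/
def traceNorm {a : Type*} [Fintype a] [DecidableEq a] (M : Matrix a a ℂ) : ℝ :=
  (CFC.sqrt (M * M.conjTranspose)).trace.re

/-- Fidelity `F(ρ, σ) = ‖√ρ √σ‖₁`. -/
def fidelity {a : Type*} [Fintype a] [DecidableEq a] (ρ σ : Matrix a a ℂ) : ℝ :=
  traceNorm (CFC.sqrt ρ * CFC.sqrt σ)

/-- Generalized fidelity of subnormalized states. -/
def genFidelity {a : Type*} [Fintype a] [DecidableEq a] (ρ σ : Matrix a a ℂ) : ℝ :=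
  fidelity ρ σ + Real.sqrt ((1 - ρ.trace.re) * (1 - σ.trace.re))

/-- Purified distance of subnormalized states. -/
def purifiedDist {a : Type*} [Fintype a] [DecidableEq a] (ρ σ : Matrix a a ℂ) : ℝ :=
  Real.sqrt (1 - genFidelity ρ σ ^ 2)

/-- The `ε`-ball of subnormalized states around `ρ` in purified distance. -/
def ball {a : Type*} [Fintype a] [DecidableEq a] (ε : ℝ) (ρ : Matrix a a ℂ) :
    Set (Matrix a a ℂ) :=
  {τ | IsSubstate τ ∧ purifiedDist ρ τ ≤ ε}

/-- Smooth min-entropy `H_min^ε(A)_ρ`, the supremum of `H_min(A)` over the `ε`-ball. -/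
def smoothMinEntropy {a : Type*} [Fintype a] [DecidableEq a] (ε : ℝ) (ρ : Matrix a a ℂ) :
    EReal :=
  ⨆ τ ∈ ball ε ρ, minEntropy τ

/-- The action `Φ ⊗ id_r` of a map `Φ` on operators of a system that has a further
tensor factor `r`. -/
def localOp {a b : Type*} (Φ : Matrix a a ℂ →ₗ[ℂ] Matrix b b ℂ) {r : Type*}
    (M : Matrix (a × r) (a × r) ℂ) : Matrix (b × r) (b × r) ℂ :=
  fun i j => Φ (fun x y => M (x, i.2) (y, j.2)) i.1 j.1

/-- Quantum channels: completely positive trace-preserving linear maps. -/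
def IsChannel {a b : Type*} [Fintype a] [Fintype b]
    (Φ : Matrix a a ℂ →ₗ[ℂ] Matrix b b ℂ) : Prop :=
  (∀ (n : ℕ) (M : Matrix (a × Fin n) (a × Fin n) ℂ), M.PosSemidef → (localOp Φ M).PosSemidef) ∧
    ∀ M : Matrix a a ℂ, (Φ M).trace = M.trace

/-- The maximally entangled state of local dimension `k` (that is, `log₂ k` ebits). -/
def maxEntangled (k : ℕ) : Matrix (Fin k × Fin k) (Fin k × Fin k) ℂ :=
  pureState fun i => if i.1 = i.2 then ((1 / Real.sqrt k : ℝ) : ℂ) else 0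

/-- `ψ` is the state vector of a purification, with purifying system `R`, of the state `ρ`. -/
def IsPurification {A B C R : Type*} [Fintype R] (ψ : A × B × C × R → ℂ)
    (ρ : Matrix (A × B × C) (A × B × C) ℂ) : Prop :=
  trSnd ((pureState ψ).submatrix
    (fun i : (A × B × C) × R => (i.1.1, i.1.2.1, i.1.2.2, i.2))
    (fun i : (A × B × C) × R => (i.1.1, i.1.2.1, i.1.2.2, i.2))) = ρ

/-- One-way ebit-assisted protocols. Alice holds `A`, `C` and her half (of dimension `kIn`) of a
maximally entangled state, Bob holds `B` and the other half. Alice applies a channel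
`A C T_A^in → A T_A^out Q`, sends the system `Q` of dimension `dQ` to Bob, and Bob applies a
channel `Q B T_B^in → B C' T_B^out`, where `C'` is a copy of `C`. The systems `T_A^out` and
`T_B^out` have dimension `kOut` and are meant to end in a maximally entangled state. -/
structure Protocol (A B C : Type*) [Fintype A] [Fintype B] [Fintype C] where
  kIn : ℕ
  kOut : ℕ
  dQ : ℕ
  kIn_pos : 0 < kIn
  kOut_pos : 0 < kOut
  dQ_pos : 0 < dQ
  enc : Matrix (A × C × Fin kIn) (A × C × Fin kIn) ℂ →ₗ[ℂ]
    Matrix (A × Fin kOut × Fin dQ) (A × Fin kOut × Fin dQ) ℂ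
  dec : Matrix (Fin dQ × B × Fin kIn) (Fin dQ × B × Fin kIn) ℂ →ₗ[ℂ]
    Matrix (B × C × Fin kOut) (B × C × Fin kOut) ℂ
  enc_channel : IsChannel enc
  dec_channel : IsChannel dec

namespace Protocol

variable {A B C : Type*} [Fintype A] [Fintype B] [Fintype C] (P : Protocol A B C)

/-- Quantum communication cost: the number `log₂ |Q|` of qubits sent. -/
def qCost : ℝ := Real.logb 2 P.dQ

/-- Net entanglement consumption: ebits consumed minus ebits generated. -/
def eCost : ℝ := Real.logb 2 P.kIn - Real.logb 2 P.kOut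

/-- The joint state after Alice's operation, from a joint input state on `A B C R T_A^in T_B^in`. -/
def afterEnc {R : Type*}
    (ω : Matrix ((A × B × C × R) × Fin P.kIn × Fin P.kIn)
      ((A × B × C × R) × Fin P.kIn × Fin P.kIn) ℂ) :
    Matrix ((A × Fin P.kOut × Fin P.dQ) × B × Fin P.kIn × R)
      ((A × Fin P.kOut × Fin P.dQ) × B × Fin P.kIn × R) ℂ :=
  localOp P.enc (ω.submatrix
    (fun ((a, c, s), b, t, r) => ((a, b, c, r), s, t))
    (fun ((a, c, s), b, t, r) => ((a, b, c, r), s, t)))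

/-- The joint state on `A B C' R T_A^out T_B^out` after the whole protocol (with `R` untouched),
from a joint input state on `A B C R T_A^in T_B^in`. -/
def output {R : Type*}
    (ω : Matrix ((A × B × C × R) × Fin P.kIn × Fin P.kIn)
      ((A × B × C × R) × Fin P.kIn × Fin P.kIn) ℂ) :
    Matrix ((A × B × C × R) × Fin P.kOut × Fin P.kOut)
      ((A × B × C × R) × Fin P.kOut × Fin P.kOut) ℂ :=
  (localOp P.dec ((P.afterEnc ω).submatrix
    (fun ((q, b, t), a, s, r) => ((a, s, q), b, t, r))
    (fun ((q, b, t), a, s, r) => ((a, s, q), b, t, r)))).submatrix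
    (fun ((a, b, c, r), s, t) => ((b, c, t), a, s, r))
    (fun ((a, b, c, r), s, t) => ((b, c, t), a, s, r))

/-- The protocol redistributes the state with purification `ψ` up to error `ε`: from
`|ψ⟩⟨ψ|` and `log₂ kIn` ebits it produces a state within purified distance `ε` of
`|ψ⟩⟨ψ|` (with `C` now at Bob's side) and `log₂ kOut` ebits. -/
def IsRedistribution [DecidableEq A] [DecidableEq B] [DecidableEq C] {R : Type*} [Fintype R]
    [DecidableEq R] (ψ : A × B × C × R → ℂ) (ε : ℝ) : Prop :=
  purifiedDist (P.output (pureState ψ ⊗ₖ maxEntangled P.kIn))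
    (pureState ψ ⊗ₖ maxEntangled P.kOut) ≤ ε

end Protocol

/-- The unconditional min-entropy is the conditional one given a one-dimensional system. -/
theorem condMinEntropy_trivial {a : Type*} [DecidableEq a] (ρ : Matrix (a × Unit) (a × Unit) ℂ) :
    condMinEntropy ρ = minEntropy ρ := by
  have h : {x : EReal | ∃ σ : Matrix Unit Unit ℂ, IsState σ ∧
      x = dMax ρ ((1 : Matrix a a ℂ) ⊗ₖ σ)} = {dMax ρ 1} := by
    ext x
    constructor
    · rintro ⟨σ, hσ, rfl⟩
      have : σ = 1 := by
        ext i j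
        have := hσ.2
        simpa [Matrix.trace] using this
      simp [this]
    · rintro rfl
      refine ⟨1, ⟨Matrix.PosSemidef.one, by simp⟩, by simp⟩
  simp [condMinEntropy, minEntropy, h]

end QSR

end

/-! A matrix `M` with rows `n` and columns `m` is read as a vector on `n ⊗ m`: `M * Mᴴ` is its
marginal on `n`, and `(M * Nᴴ).trace.re` is the real part of an inner product. Uhlmann's theorem
(`exists_uhlmann`, `re_trace_le_fidelity`) then turns purified distance into overlaps of vectors.

Dilate Bob's channel to an isometry `V` with environment `E`, and purify his input to `v` with a
system `F`. The target is pure, so `V * v` has a large overlap with a product of `ψ`, `Φ₂` and a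
unit vector `w` on `E ⊗ F`. Let `τ ≤ κ • 1` be a smoothing of `ρ` on `BC`. Replacing `ψ` by an
Uhlmann vector `χ` with marginal below `τ` gives a vector whose marginal on `B C' T_B^out E` is at
most `κ / kOut`, and the triangle inequality adds the two errors. Pulling back by `Vᴴ` preserves the
operator bound, and tracing out `Q` and `T_B^in` multiplies it by `dQ * kIn`. Since Alice's channel
does not change the marginal on `B`, this yields a smoothing of `ρ` on `B` bounded by `κ * dQ * kIn
/ kOut` (`Protocol.exists_mem_ball`). Logarithms give the theorem. -/

noncomputable section
namespace QSR

open scoped Kronecker MatrixOrder ComplexOrder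
open Matrix

/-! ### Polar decomposition, fidelity and Uhlmann's theorem. -/

section Polar
variable {n m l : Type*} [Fintype n] [Fintype m] [Fintype l]
  [DecidableEq n]

/-- Take `C = H^(-1/2) * M` with `H = M * Mᴴ`, the inverse being zero on the kernel of `H`. This
contraction replaces the unitary of the polar decomposition and also serves rectangular `M`. -/
theorem exists_polar (M : Matrix n m ℂ) : ∃ C : Matrix n m ℂ,
    M * Cᴴ = CFC.sqrt (M * Mᴴ) ∧ CFC.sqrt (M * Mᴴ) * C = M ∧ C * Cᴴ ≤ 1 := by
  set H := M * Mᴴ with hH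
  have hpos : 0 ≤ H := (posSemidef_self_mul_conjTranspose M).nonneg
  have hsa : IsSelfAdjoint H := .of_nonneg hpos
  have hc (f : ℝ → ℝ) : ContinuousOn f (spectrum ℝ H) :=
    (Matrix.finite_real_spectrum (A := H)).continuousOn _
  have hspec : ∀ x ∈ spectrum ℝ H, 0 ≤ x := fun x hx => spectrum_nonneg_of_nonneg hpos hx
  have hs : CFC.sqrt H = cfc Real.sqrt H := by
    rw [CFC.sqrt_eq_real_sqrt H hpos, cfcₙ_eq_cfc]
  set g : Matrix n n ℂ := cfc (fun x : ℝ => (√x)⁻¹) H with hg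
  have hgsa : gᴴ = g := (cfc_predicate (fun x : ℝ => (√x)⁻¹) H : IsSelfAdjoint g)
  have hid : cfc (fun x : ℝ => x) H = H := cfc_id' ℝ H
  refine ⟨g * M, ?_, ?_, ?_⟩
  · rw [conjTranspose_mul, hgsa, ← Matrix.mul_assoc, ← hH, hs]
    nth_rw 1 [← hid]
    rw [hg, ← cfc_mul _ _ H (hc _) (hc _)]
    refine cfc_congr fun x _ => ?_
    exact Real.div_sqrt
  · rw [hs, ← Matrix.mul_assoc, hg, ← cfc_mul _ _ H (hc _) (hc _), ← sub_eq_zero]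
    set p := cfc (fun x : ℝ => √x * (√x)⁻¹) H with hp
    -- `p` is the support projection of `H`; it fixes `M * Mᴴ`, hence also `M`.
    have h1 : (p - 1) * (M * Mᴴ) = 0 := by
      rw [← hH, sub_mul, one_mul, sub_eq_zero]
      conv_lhs => rw [← hid]
      conv_rhs => rw [← hid]
      rw [hp, ← cfc_mul _ _ H (hc _) (hc _)]
      refine cfc_congr fun x hx => ?_
      rcases (hspec x hx).eq_or_lt with rfl | h
      · simp
      · have : √x ≠ 0 := (Real.sqrt_pos.2 h).ne'
        simp [this]
    rw [Matrix.mul_self_mul_conjTranspose_eq_zero] at h1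
    rwa [Matrix.sub_mul, Matrix.one_mul] at h1
  · have : g * M * (g * M)ᴴ = cfc (fun x : ℝ => (√x)⁻¹ * (x * (√x)⁻¹)) H := by
      rw [conjTranspose_mul, hgsa, cfc_mul _ _ H (hc _) (hc _), cfc_mul _ _ H (hc _) (hc _), hid,
        ← hg, hH]
      simp only [Matrix.mul_assoc]
    rw [this]
    refine cfc_le_one _ _ fun x hx => ?_
    have h2 : x * (√x)⁻¹ = √x := Real.div_sqrt
    rw [h2]
    exact inv_mul_le_one

/-- Both inequalities are Schur complement criteria for positivity of the block matrix with
identities on the diagonal and `C`, `Cᴴ` off it. -/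
theorem conjTranspose_mul_self_le_one [DecidableEq m] {C : Matrix n m ℂ} (h : C * Cᴴ ≤ 1) : Cᴴ * C ≤ 1 := by
  rw [Matrix.le_iff] at h ⊢
  let : Invertible (1 : Matrix n n ℂ) := invertibleOne
  let : Invertible (1 : Matrix m m ℂ) := invertibleOne
  have e1 := Matrix.PosDef.fromBlocks₁₁ (A := (1 : Matrix n n ℂ)) C (1 : Matrix m m ℂ) .one
  have e2 := Matrix.PosDef.fromBlocks₂₂ (D := (1 : Matrix m m ℂ)) (1 : Matrix n n ℂ) C .one
  simp only [inv_one, Matrix.mul_one] at e1 e2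
  exact e1.1 (e2.2 h)

omit [DecidableEq n] in
theorem conj_mono {A B : Matrix n n ℂ} (h : A ≤ B) (K : Matrix m n ℂ) :
    K * A * Kᴴ ≤ K * B * Kᴴ := by
  rw [Matrix.le_iff] at h ⊢
  have := h.mul_mul_conjTranspose_same K
  rwa [Matrix.mul_sub, Matrix.sub_mul] at this

theorem mul_mul_conjTranspose_le [DecidableEq m] {C : Matrix n m ℂ} {D : Matrix m l ℂ} (hC : C * Cᴴ ≤ 1)
    (hD : D * Dᴴ ≤ 1) : (C * D) * (C * D)ᴴ ≤ 1 := by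
  have := conj_mono hD C
  rw [Matrix.mul_one] at this
  rw [conjTranspose_mul]
  simpa only [Matrix.mul_assoc] using this.trans hC

omit [DecidableEq n] in
theorem trace_re_mono {A B : Matrix n n ℂ} (h : A ≤ B) : A.trace.re ≤ B.trace.re := by
  rw [Matrix.le_iff] at h
  have := (Complex.le_def.1 h.trace_nonneg).1
  simpa [trace_sub] using this

theorem sqrt_conjTranspose (A : Matrix n n ℂ) : (CFC.sqrt A)ᴴ = CFC.sqrt A :=
  (IsSelfAdjoint.of_nonneg (CFC.sqrt_nonneg A) : IsSelfAdjoint (CFC.sqrt A))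

theorem sqrt_mul_sqrt {A : Matrix n n ℂ} (hA : A.PosSemidef) : CFC.sqrt A * CFC.sqrt A = A :=
  CFC.sqrt_mul_sqrt_self A hA.nonneg

/-- Expanding `(1 - L) * (1 - L)ᴴ ≥ 0` gives `L + Lᴴ ≤ 1 + L * Lᴴ ≤ 2`; conjugate by `√S` and take
traces. -/
theorem re_trace_mul_le {S L : Matrix n n ℂ} (hS : S.PosSemidef) (hL : L * Lᴴ ≤ 1) :
    (S * L).trace.re ≤ S.trace.re := by
  have h1 : L + Lᴴ ≤ 1 + 1 := by
    refine le_trans (b := 1 + L * Lᴴ) ?_ (by gcongr)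
    rw [Matrix.le_iff]
    have := posSemidef_self_mul_conjTranspose (1 - L)
    have e : (1 - L) * (1 - L)ᴴ = 1 + L * Lᴴ - (L + Lᴴ) := by
      rw [conjTranspose_sub, conjTranspose_one]
      noncomm_ring
    rwa [e] at this
  have h2 := trace_re_mono (conj_mono h1 (CFC.sqrt S))
  rw [sqrt_conjTranspose, trace_mul_cycle, sqrt_mul_sqrt hS, trace_mul_cycle,
    sqrt_mul_sqrt hS] at h2
  have h3 : (S * Lᴴ).trace.re = (S * L).trace.re := by
    have : (S * Lᴴ).trace = star (S * L).trace := by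
      rw [← trace_conjTranspose, conjTranspose_mul, hS.1.eq, trace_mul_comm]
    rw [this]; simp
  simp only [Matrix.mul_add, Matrix.mul_one, trace_add, Complex.add_re, h3] at h2
  linarith

/-- Any two purifications bound the fidelity from below. -/
theorem re_trace_le_fidelity (U W : Matrix n m ℂ) :
    (U * Wᴴ).trace.re ≤ fidelity (U * Uᴴ) (W * Wᴴ) := by
  classical
  obtain ⟨G, -, hG, hG1⟩ := exists_polar U
  obtain ⟨K, -, hK, hK1⟩ := exists_polar W
  set r := CFC.sqrt (U * Uᴴ) with hr
  set s := CFC.sqrt (W * Wᴴ) with hs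
  have hss : sᴴ = s := sqrt_conjTranspose _
  have hrr : rᴴ = r := sqrt_conjTranspose _
  clear_value r s
  obtain ⟨D, -, hD, hD1⟩ := exists_polar (r * s)
  have hpos : (CFC.sqrt ((r * s) * (r * s)ᴴ)).PosSemidef := (CFC.sqrt_nonneg _).posSemidef
  -- With `U = r * G`, `W = s * K` and `r * s = |(r * s)ᴴ| * D`, the overlap is, up to conjugation,
  -- the trace of `|(r * s)ᴴ|` against the contraction `D * K * Gᴴ`.
  have key : (U * Wᴴ).trace =
      star (CFC.sqrt ((r * s) * (r * s)ᴴ) * (D * (K * Gᴴ))).trace := by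
    rw [← Matrix.mul_assoc, hD, ← trace_conjTranspose, ← hG, ← hK]
    simp only [conjTranspose_mul, conjTranspose_conjTranspose, hss, hrr, Matrix.mul_assoc]
    rw [trace_mul_comm]
    simp only [Matrix.mul_assoc]
  rw [key, fidelity, traceNorm, ← hr, ← hs]
  have hG2 : Gᴴ * Gᴴᴴ ≤ 1 := by
    rw [conjTranspose_conjTranspose]
    exact conjTranspose_mul_self_le_one hG1
  have h0 : (K * Gᴴ) * (K * Gᴴ)ᴴ ≤ 1 := mul_mul_conjTranspose_le hK1 hG2
  have h1 := re_trace_mul_le hpos (mul_mul_conjTranspose_le hD1 h0)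
  rw [Complex.star_def, Complex.conj_re]
  exact h1

/-- Uhlmann's theorem for a given purification of the first state; the second state is purified
up to a deficit. -/
theorem exists_uhlmann (Ψ : Matrix n m ℂ) {τ : Matrix n n ℂ} (hτ : τ.PosSemidef) :
    ∃ W : Matrix n m ℂ, W * Wᴴ ≤ τ ∧ (Ψ * Wᴴ).trace.re = fidelity (Ψ * Ψᴴ) τ := by
  obtain ⟨G, hG, -, hG1⟩ := exists_polar Ψ
  set r := CFC.sqrt (Ψ * Ψᴴ) with hr
  set s := CFC.sqrt τ with hs
  have hss : sᴴ = s := sqrt_conjTranspose _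
  have hrr : rᴴ = r := sqrt_conjTranspose _
  obtain ⟨D, hD, -, hD1⟩ := exists_polar (r * s)
  -- `G` turns `Ψ` into `r` and `D` turns `r * s` into its absolute value, so the overlap is exactly
  -- the fidelity. As `Dᴴ * G` is only a contraction, the marginal may fall below `τ`.
  refine ⟨s * (Dᴴ * G), ?_, ?_⟩
  · have h1 : (Dᴴ * G) * (Dᴴ * G)ᴴ ≤ 1 :=
      mul_mul_conjTranspose_le (by simpa using conjTranspose_mul_self_le_one hD1) hG1
    have := conj_mono h1 s
    rw [Matrix.mul_one, hss, sqrt_mul_sqrt hτ] at this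
    rw [conjTranspose_mul s, hss]
    simpa only [Matrix.mul_assoc] using this
  · rw [fidelity, traceNorm, ← hr, ← hs, ← hD, conjTranspose_mul s, conjTranspose_mul Dᴴ, hss,
      conjTranspose_conjTranspose]
    have : Ψ * (Gᴴ * D * s) = r * (D * s) := by
      rw [← hG]; simp only [Matrix.mul_assoc]
    rw [this]
    have e : (r * (D * s)).trace = star (r * s * Dᴴ).trace := by
      rw [← trace_conjTranspose]
      simp only [conjTranspose_mul, conjTranspose_conjTranspose, hss, hrr]
      rw [← Matrix.mul_assoc, trace_mul_comm, ← Matrix.mul_assoc, trace_mul_comm]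
    rw [e]; simp

end Polar

/-! ### Triangle inequality for overlaps of vectors. -/

section Overlap

/-- Remove from `a` and `c` their components along `b` and apply Cauchy–Schwarz to the remainders:
the addition formula for the cosine, as an inequality. -/
theorem inner_triangle {E : Type*} [NormedAddCommGroup E] [InnerProductSpace ℝ E] {a b c : E}
    (ha : ‖a‖ ≤ 1) (hb : ‖b‖ = 1) (hc : ‖c‖ ≤ 1) :
    inner ℝ a b * inner ℝ b c - √(1 - inner ℝ a b ^ 2) * √(1 - inner ℝ b c ^ 2) ≤
      inner ℝ a c := by
  have hbb : inner ℝ b b = (1 : ℝ) := by rw [real_inner_self_eq_norm_sq, hb, one_pow]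
  set x := inner ℝ a b with hx
  set y := inner ℝ b c with hy
  have h1 : ‖a - x • b‖ ≤ √(1 - x ^ 2) := by
    apply Real.le_sqrt_of_sq_le
    rw [norm_sub_sq_real, inner_smul_right, norm_smul, hb, ← hx, mul_one, Real.norm_eq_abs, sq_abs]
    nlinarith [norm_nonneg a]
  have h2 : ‖c - y • b‖ ≤ √(1 - y ^ 2) := by
    apply Real.le_sqrt_of_sq_le
    rw [norm_sub_sq_real, inner_smul_right, norm_smul, hb, real_inner_comm b c, ← hy, mul_one,
      Real.norm_eq_abs, sq_abs]
    nlinarith [norm_nonneg c]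
  have h3 : inner ℝ (a - x • b) (c - y • b) = inner ℝ a c - x * y := by
    simp only [inner_sub_left, inner_sub_right, inner_smul_left, inner_smul_right, hbb, ← hx, ← hy]
    simp
  have h4 := neg_le_of_abs_le (abs_real_inner_le_norm (a - x • b) (c - y • b))
  have h5 : ‖a - x • b‖ * ‖c - y • b‖ ≤ √(1 - x ^ 2) * √(1 - y ^ 2) := by gcongr
  linarith

/-- Put `p = √((1 - ε₁²)(1 - ε₂²))`. Then `z ≥ p - ε₁ε₂`, which is nonnegative because `ε₁ + ε₂ ≤
1`, and `(p - ε₁ε₂)² - (1 - (ε₁ + ε₂)²) = 2ε₁ε₂(1 + ε₁ε₂ - p) ≥ 0` because `p ≤ 1`. -/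
theorem sq_overlap_bound {x y z ε₁ ε₂ : ℝ} (hε₁ : 0 ≤ ε₁) (hε₂ : 0 ≤ ε₂) (hε : ε₁ + ε₂ ≤ 1)
    (hx : 0 ≤ x) (hy : 0 ≤ y) (hx1 : 1 - ε₁ ^ 2 ≤ x ^ 2) (hy1 : 1 - ε₂ ^ 2 ≤ y ^ 2)
    (hz : x * y - √(1 - x ^ 2) * √(1 - y ^ 2) ≤ z) :
    0 ≤ z ∧ 1 - (ε₁ + ε₂) ^ 2 ≤ z ^ 2 := by
  have h1 : √(1 - x ^ 2) ≤ ε₁ := Real.sqrt_le_iff.2 ⟨hε₁, by linarith⟩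
  have h2 : √(1 - y ^ 2) ≤ ε₂ := Real.sqrt_le_iff.2 ⟨hε₂, by linarith⟩
  have h3 : √(1 - x ^ 2) * √(1 - y ^ 2) ≤ ε₁ * ε₂ := by gcongr
  have a1 : 0 ≤ 1 - ε₁ ^ 2 := by nlinarith
  have a2 : 0 ≤ 1 - ε₂ ^ 2 := by nlinarith
  obtain ⟨p, hp⟩ : ∃ p, p = √((1 - ε₁ ^ 2) * (1 - ε₂ ^ 2)) := ⟨_, rfl⟩
  have hp0 : 0 ≤ p := hp ▸ Real.sqrt_nonneg _
  have hp2 : p ^ 2 = (1 - ε₁ ^ 2) * (1 - ε₂ ^ 2) := by rw [hp, Real.sq_sqrt (mul_nonneg a1 a2)]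
  have hpxy : p ≤ x * y := by
    refine abs_le_of_sq_le_sq' ?_ (mul_nonneg hx hy) |>.2
    rw [hp2, mul_pow]
    gcongr
  have hp1 : p ≤ 1 := by
    refine abs_le_of_sq_le_sq' ?_ zero_le_one |>.2
    rw [hp2]
    nlinarith [sq_nonneg ε₁, sq_nonneg ε₂]
  have hm : 0 ≤ ε₁ * ε₂ := mul_nonneg hε₁ hε₂
  have hpe : ε₁ * ε₂ ≤ p := by
    refine abs_le_of_sq_le_sq' ?_ hp0 |>.2
    rw [hp2]
    nlinarith
  have hz0 : p - ε₁ * ε₂ ≤ z := by linarith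
  refine ⟨by linarith, ?_⟩
  have : (p - ε₁ * ε₂) ^ 2 ≤ z ^ 2 := by
    have : 0 ≤ p - ε₁ * ε₂ := by linarith
    gcongr
  nlinarith

variable {n m : Type*} [Fintype n] [Fintype m]

theorem trace_mul_conjTranspose_re (a b : Matrix n m ℂ) :
    (a * bᴴ).trace.re = ∑ i, ∑ j, (a i j * star (b i j)).re := by
  simp [Matrix.trace, Matrix.mul_apply]

theorem exists_inner_eq_trace : ∃ v : Matrix n m ℂ → EuclideanSpace ℝ ((n × m) × Fin 2),
    ∀ M N, inner ℝ (v M) (v N) = (M * Nᴴ).trace.re := by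
  refine ⟨fun M => WithLp.toLp 2 fun i => if i.2 = 0 then (M i.1.1 i.1.2).re else
    (M i.1.1 i.1.2).im, fun M N => ?_⟩
  rw [trace_mul_conjTranspose_re, PiLp.inner_apply]
  simp only [Fintype.sum_prod_type, Fin.sum_univ_two]
  refine Finset.sum_congr rfl fun i _ => Finset.sum_congr rfl fun j _ => ?_
  simp
  ring

theorem trace_triangle {a b c : Matrix n m ℂ} (ha : (a * aᴴ).trace.re ≤ 1)
    (hb : (b * bᴴ).trace.re = 1) (hc : (c * cᴴ).trace.re ≤ 1) :
    (a * bᴴ).trace.re * (b * cᴴ).trace.re -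
      √(1 - (a * bᴴ).trace.re ^ 2) * √(1 - (b * cᴴ).trace.re ^ 2) ≤ (a * cᴴ).trace.re := by
  obtain ⟨v, hv⟩ := exists_inner_eq_trace (n := n) (m := m)
  simp only [← hv] at ha hb hc ⊢
  simp only [real_inner_self_eq_norm_sq] at ha hb hc
  refine inner_triangle ?_ ?_ ?_
  · exact (sq_le_one_iff₀ (norm_nonneg _)).1 ha
  · exact (pow_eq_one_iff_of_nonneg (norm_nonneg _) two_ne_zero).1 hb
  · exact (sq_le_one_iff₀ (norm_nonneg _)).1 hc

theorem trace_cauchy_schwarz (a b : Matrix n m ℂ) :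
    (a * bᴴ).trace.re ^ 2 ≤ (a * aᴴ).trace.re * (b * bᴴ).trace.re := by
  obtain ⟨v, hv⟩ := exists_inner_eq_trace (n := n) (m := m)
  simp only [← hv]
  rw [sq]
  exact real_inner_mul_inner_self_le _ _

end Overlap

/-! ### Smoothing balls and finiteness of the smooth min-entropy. -/

section Smooth
variable {n : Type*} [Fintype n] [DecidableEq n]

theorem fidelity_nonneg (ρ σ : Matrix n n ℂ) : 0 ≤ fidelity ρ σ := by
  have := (Complex.le_def.1 (CFC.sqrt_nonneg
    (CFC.sqrt ρ * CFC.sqrt σ * (CFC.sqrt ρ * CFC.sqrt σ)ᴴ)).posSemidef.trace_nonneg).1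
  simpa [fidelity, traceNorm] using this

theorem sq_fidelity_of_purifiedDist_le {ρ σ : Matrix n n ℂ} {ε : ℝ} (hε : 0 ≤ ε)
    (h1 : ρ.trace.re = 1 ∨ σ.trace.re = 1) (h : purifiedDist ρ σ ≤ ε) :
    1 - ε ^ 2 ≤ fidelity ρ σ ^ 2 := by
  have : genFidelity ρ σ = fidelity ρ σ := by
    rcases h1 with h1 | h1 <;> simp [genFidelity, h1]
  rw [purifiedDist, this, Real.sqrt_le_left hε] at h
  linarith

theorem purifiedDist_le_of_overlap {ρ σ : Matrix n n ℂ} {ε z : ℝ} (hε : 0 ≤ ε)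
    (h1 : ρ.trace.re = 1) (hz : 0 ≤ z) (hz1 : 1 - ε ^ 2 ≤ z ^ 2) (hzF : z ≤ fidelity ρ σ) :
    purifiedDist ρ σ ≤ ε := by
  have : genFidelity ρ σ = fidelity ρ σ := by simp [genFidelity, h1]
  rw [purifiedDist, this, Real.sqrt_le_left hε]
  have : z ^ 2 ≤ fidelity ρ σ ^ 2 := by gcongr
  linarith

theorem self_mem_ball {ρ : Matrix n n ℂ} (hρ : IsState ρ) {ε : ℝ} (hε : 0 ≤ ε) :
    ρ ∈ ball ε ρ := by
  have ht : ρ.trace.re = 1 := by rw [hρ.2]; rfl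
  refine ⟨⟨hρ.1, ht.le⟩, purifiedDist_le_of_overlap hε ht zero_le_one (by nlinarith) ?_⟩
  have := re_trace_le_fidelity (CFC.sqrt ρ) (CFC.sqrt ρ)
  rwa [sqrt_conjTranspose, sqrt_mul_sqrt hρ.1, ht] at this

/-- An Uhlmann vector `W` for `τ` has squared overlap at least `1 - ε²` with a unit vector, so
Cauchy–Schwarz bounds its squared norm, hence the trace of `τ`, from below. -/
theorem le_trace_of_mem_ball {ρ τ : Matrix n n ℂ} (hρ : IsState ρ) {ε : ℝ} (hε : 0 ≤ ε)
    (hτ : τ ∈ ball ε ρ) : 1 - ε ^ 2 ≤ τ.trace.re := by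
  have ht : ρ.trace.re = 1 := by rw [hρ.2]; rfl
  obtain ⟨W, hW, hF⟩ := exists_uhlmann (CFC.sqrt ρ) hτ.1.1
  have h1 := sq_fidelity_of_purifiedDist_le hε (.inl ht) hτ.2
  have h2 := trace_cauchy_schwarz (CFC.sqrt ρ) W
  rw [hF, sqrt_conjTranspose, sqrt_mul_sqrt hρ.1, ht, one_mul] at h2
  exact h1.trans (h2.trans (trace_re_mono hW))

omit [Fintype n] in
theorem le_minEntropy {τ : Matrix n n ℂ} {t : ℝ} (h : τ ≤ ((2 : ℝ) ^ t) • (1 : Matrix n n ℂ)) :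
    ((-t : ℝ) : EReal) ≤ minEntropy τ := by
  rw [minEntropy, EReal.coe_neg, EReal.neg_le_neg_iff]
  exact sInf_le ⟨t, h, rfl⟩

omit [Fintype n] in
theorem minEntropy_le {τ : Matrix n n ℂ} {s : ℝ}
    (h : ∀ t : ℝ, τ ≤ ((2 : ℝ) ^ t) • (1 : Matrix n n ℂ) → -t ≤ s) : minEntropy τ ≤ (s : EReal) := by
  rw [minEntropy, EReal.neg_le, ← EReal.coe_neg]
  refine le_sInf ?_
  rintro _ ⟨t, ht, rfl⟩
  exact EReal.coe_le_coe_iff.2 (by linarith [h t ht])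

open scoped Matrix.Norms.L2Operator in
theorem exists_le_two_rpow (τ : Matrix n n ℂ) (hτ : τ.PosSemidef) :
    ∃ t : ℝ, τ ≤ ((2 : ℝ) ^ t) • (1 : Matrix n n ℂ) := by
  have hp : 0 < ‖τ‖ + 1 := by positivity
  refine ⟨Real.logb 2 (‖τ‖ + 1), ?_⟩
  rw [Real.rpow_logb zero_lt_two (by norm_num) hp, add_smul, one_smul,
    ← Algebra.algebraMap_eq_smul_one]
  have h1 : τ ≤ algebraMap ℝ _ ‖τ‖ := IsSelfAdjoint.le_algebraMap_norm_self hτ.1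
  exact h1.trans (le_add_of_nonneg_right PosSemidef.one.nonneg)

/-- The centre `ρ` bounds the supremum from below. Above, traces in the ball stay at least `1 - ε² >
0`, and `τ ≤ 2 ^ t • 1` bounds the trace by `2 ^ t` times the dimension. -/
theorem exists_smoothMinEntropy_eq {ρ : Matrix n n ℂ} (hρ : IsState ρ) {ε : ℝ} (hε : 0 ≤ ε)
    (hε1 : ε < 1) : ∃ h : ℝ, smoothMinEntropy ε ρ = (h : EReal) := by
  have hδ : 0 < 1 - ε ^ 2 := by nlinarith
  obtain ⟨t₀, ht₀⟩ := exists_le_two_rpow ρ hρ.1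
  have hlow : ((-t₀ : ℝ) : EReal) ≤ smoothMinEntropy ε ρ :=
    (le_minEntropy ht₀).trans (le_iSup₂_of_le ρ (self_mem_ball hρ hε) le_rfl)
  have hup : smoothMinEntropy ε ρ ≤
      ((-Real.logb 2 ((1 - ε ^ 2) / Fintype.card n) : ℝ) : EReal) := by
    refine iSup₂_le fun τ hτ => minEntropy_le fun t ht => ?_
    have h1 := (le_trace_of_mem_ball hρ hε hτ).trans (trace_re_mono ht)
    rw [trace_smul, trace_one, Complex.real_smul] at h1
    have h2 : 1 - ε ^ 2 ≤ (2 : ℝ) ^ t * Fintype.card n := by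
      simpa only [Complex.re_ofReal_mul, Complex.natCast_re] using h1
    have hc : 0 < (Fintype.card n : ℝ) := by
      by_contra hc
      have : (Fintype.card n : ℝ) = 0 := le_antisymm (not_lt.1 hc) (Nat.cast_nonneg _)
      rw [this] at h2
      linarith
    rw [neg_le_neg_iff, Real.logb_le_iff_le_rpow one_lt_two (div_pos hδ hc), div_le_iff₀ hc]
    exact h2
  refine ⟨(smoothMinEntropy ε ρ).toReal, (EReal.coe_toReal ?_ ?_).symm⟩
  · exact fun h => by rw [h] at hup; exact absurd hup (by simp)
  · exact fun h => by rw [h] at hlow; exact absurd hlow (by simp)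

end Smooth

/-! ### Stinespring dilation of channels. -/

section Stinespring
variable {a b : Type*} [Fintype a] [Fintype b]

theorem IsChannel.posSemidef_localOp {Φ : Matrix a a ℂ →ₗ[ℂ] Matrix b b ℂ} (hΦ : IsChannel Φ)
    {r : Type*} [Fintype r] {M : Matrix (a × r) (a × r) ℂ} (hM : M.PosSemidef) :
    (localOp Φ M).PosSemidef := by
  let e := Fintype.equivFin r
  have h := hΦ.1 _ _ (hM.submatrix (Prod.map id e.symm))
  have h2 := h.submatrix (Prod.map id e)
  convert h2 using 1
  ext i j
  simp [localOp]

/-- The columns of the square root of the Choi matrix `J` are Kraus operators, indexed by the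
environment `b × a`; stacked, they form `V`. Trace preservation on matrix units is `Vᴴ * V = 1`. -/
theorem IsChannel.exists_isometry [DecidableEq a] [DecidableEq b]
    {Φ : Matrix a a ℂ →ₗ[ℂ] Matrix b b ℂ}
    (hΦ : IsChannel Φ) : ∃ V : Matrix (b × (b × a)) a ℂ, Vᴴ * V = 1 ∧
      ∀ M, Φ M = trSnd (V * M * Vᴴ) := by
  have hJ : (localOp Φ (pureState fun i : a × a => if i.1 = i.2 then (1 : ℂ) else 0)).PosSemidef :=
    hΦ.posSemidef_localOp (posSemidef_vecMulVec_self_star _)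
  set J := localOp Φ (pureState fun i : a × a => if i.1 = i.2 then (1 : ℂ) else 0) with hJd
  have hJa (i j : b) (k l : a) : J (i, k) (j, l) = Φ (single k l 1) i j := by
    have h : (fun x y => pureState (fun i : a × a => if i.1 = i.2 then (1 : ℂ) else 0)
        (x, k) (y, l)) = single k l (1 : ℂ) := by
      ext x y
      simp [pureState, vecMulVec_apply, single_apply]
      grind
    simp only [hJd, localOp, h]
  set S := CFC.sqrt J with hS
  have hSJ (p q : b × a) : ∑ e, S p e * star (S q e) = J p q := by
    have := congrFun (congrFun (sqrt_mul_sqrt hJ) p) q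
    rw [← this, Matrix.mul_apply]
    refine Finset.sum_congr rfl fun e _ => ?_
    rw [← conjTranspose_apply, sqrt_conjTranspose]
  refine ⟨of fun p k => S (p.1, k) p.2, ?_, fun M => ?_⟩
  · ext l k
    have h1 : ∑ i, J (i, k) (i, l) = if k = l then 1 else 0 := by
      simp only [hJa]
      have := hΦ.2 (single k l 1)
      rw [Matrix.trace] at this
      simp only [Matrix.diag] at this
      rw [this]
      by_cases h : k = l
      · subst h; simp
      · simp [h]
    simp only [Matrix.mul_apply, conjTranspose_apply, of_apply]
    rw [Fintype.sum_prod_type]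
    simp only [mul_comm (star _)]
    simp only [hSJ, h1, Matrix.one_apply, eq_comm]
  · ext i j
    have h0 : Φ M i j = ∑ k, ∑ l, M k l * J (i, k) (j, l) := by
      conv_lhs => rw [matrix_eq_sum_single M]
      simp only [map_sum, Matrix.sum_apply]
      refine Finset.sum_congr rfl fun k _ => Finset.sum_congr rfl fun l _ => ?_
      rw [hJa, ← mul_one (M k l), ← smul_eq_mul, ← smul_single, map_smul]
      simp
    rw [h0]
    simp only [trSnd, Matrix.mul_apply, conjTranspose_apply, of_apply, ← hSJ]
    simp only [Finset.sum_mul, Finset.mul_sum]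
    rw [Finset.sum_comm]
    conv_rhs => rw [Finset.sum_comm]
    refine Finset.sum_congr rfl fun l _ => ?_
    rw [Finset.sum_comm]
    refine Finset.sum_congr rfl fun e _ => Finset.sum_congr rfl fun k _ => ?_
    ring

end Stinespring

/-! ### Overlap with a pure target state. -/

section Pure
variable {n m : Type*} [Fintype n] [Fintype m] [DecidableEq n]

theorem le_trace_smul_one {A : Matrix n n ℂ} (hA : A.PosSemidef) :
    A ≤ A.trace.re • (1 : Matrix n n ℂ) := by
  rw [← Algebra.algebraMap_eq_smul_one]
  refine le_algebraMap_of_spectrum_le (fun x hx => ?_) hA.1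
  rw [hA.1.spectrum_real_eq_range_eigenvalues] at hx
  obtain ⟨i, rfl⟩ := hx
  have : A.trace.re = ∑ i, hA.1.eigenvalues i := by
    rw [hA.1.trace_eq_sum_eigenvalues]; simp
  rw [this]
  exact Finset.single_le_sum (fun j _ => hA.eigenvalues_nonneg j) (Finset.mem_univ i)

theorem trace_pureState_re (w : m → ℂ) : (pureState w).trace.re = ∑ i, ‖w i‖ ^ 2 := by
  rw [pureState, Matrix.trace, Complex.re_sum]
  refine Finset.sum_congr rfl fun i _ => ?_
  rw [diag_apply, vecMulVec_apply, Pi.star_apply, Complex.star_def, Complex.mul_conj,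
    Complex.ofReal_re, Complex.normSq_eq_norm_sq]

omit [DecidableEq n] in
theorem vecMulVec_mul_conjTranspose_trace_re (φ : n → ℂ) (w : m → ℂ) :
    (vecMulVec φ w * (vecMulVec φ w)ᴴ).trace.re =
      (pureState φ).trace.re * (pureState w).trace.re := by
  rw [trace_pureState_re, trace_pureState_re, trace_mul_conjTranspose_re, Finset.sum_mul_sum]
  refine Finset.sum_congr rfl fun i _ => Finset.sum_congr rfl fun j _ => ?_
  rw [vecMulVec_apply, Complex.star_def, Complex.mul_conj, Complex.ofReal_re,
    Complex.normSq_eq_norm_sq, norm_mul, mul_pow]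

/-- The projection `N` orthogonal to `φ` annihilates the upper bound, hence `N * W = 0`: a vector
whose marginal lies below a pure state is a product. -/
theorem eq_vecMulVec_of_le_pureState {φ : n → ℂ} (hφ : (pureState φ).trace = 1)
    {W : Matrix n m ℂ} (hW : W * Wᴴ ≤ pureState φ) : ∃ w : m → ℂ, W = vecMulVec φ w := by
  have hd : star φ ⬝ᵥ φ = 1 := by
    rw [← hφ, pureState, trace_vecMulVec, dotProduct_comm]
  set N : Matrix n n ℂ := 1 - pureState φ with hN
  have hNφ : N * pureState φ = 0 := by
    rw [hN, Matrix.sub_mul, Matrix.one_mul, pureState, vecMulVec_mul_vecMulVec, hd]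
    simp
  have h1 := conj_mono hW N
  rw [hNφ, Matrix.zero_mul] at h1
  have h2 : (N * W) * (N * W)ᴴ = 0 := by
    refine le_antisymm ?_ (posSemidef_self_mul_conjTranspose _).nonneg
    rw [conjTranspose_mul]
    simpa only [Matrix.mul_assoc] using h1
  rw [self_mul_conjTranspose_eq_zero, hN, Matrix.sub_mul, Matrix.one_mul, sub_eq_zero] at h2
  refine ⟨star φ ᵥ* W, ?_⟩
  conv_lhs => rw [h2, pureState, vecMulVec_mul]

/-- If the state purified by `Ψ` overlaps with a pure state `φ`, then `Ψ` overlaps at least as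
much with a product `φ ⊗ w`. -/
theorem exists_product_overlap (Ψ : Matrix n m ℂ) {φ : n → ℂ} (hφ : (pureState φ).trace = 1)
    (hF : 0 < fidelity (Ψ * Ψᴴ) (pureState φ)) :
    ∃ w : m → ℂ, (pureState w).trace.re = 1 ∧
      fidelity (Ψ * Ψᴴ) (pureState φ) ≤ (Ψ * (vecMulVec φ w)ᴴ).trace.re := by
  obtain ⟨W, hW, hWF⟩ := exists_uhlmann Ψ
    (show (pureState φ).PosSemidef from posSemidef_vecMulVec_self_star φ)
  obtain ⟨w, rfl⟩ := eq_vecMulVec_of_le_pureState hφ hW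
  have h1 := trace_re_mono hW
  rw [vecMulVec_mul_conjTranspose_trace_re, hφ, Complex.one_re, one_mul] at h1
  set s := (pureState w).trace.re with hs
  have hs0 : 0 ≤ s := by rw [hs, trace_pureState_re]; positivity
  have hs1 : 0 < s := by
    refine hs0.lt_of_ne fun h => ?_
    have hw : w = 0 := by
      rw [hs, trace_pureState_re, eq_comm, Finset.sum_eq_zero_iff_of_nonneg
        (fun _ _ => by positivity)] at h
      ext i
      simpa using h i (Finset.mem_univ i)
    simp [hw] at hWF
    linarith
  have hq : 0 < √s := Real.sqrt_pos.2 hs1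
  -- The norm `√s` is at most one, so normalizing can only increase the positive overlap.
  refine ⟨(√s)⁻¹ • w, ?_, ?_⟩
  · have : ∑ i, ‖((√s)⁻¹ • w) i‖ ^ 2 = (√s)⁻¹ ^ 2 * s := by
      rw [hs, trace_pureState_re, Finset.mul_sum]
      refine Finset.sum_congr rfl fun i _ => ?_
      rw [Pi.smul_apply, norm_smul, mul_pow, Real.norm_eq_abs, sq_abs]
    rw [trace_pureState_re, this, inv_pow, Real.sq_sqrt hs0, inv_mul_cancel₀ hs1.ne']
  · rw [vecMulVec_smul, conjTranspose_smul, Matrix.mul_smul, trace_smul, star_trivial,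
      Complex.smul_re, hWF, smul_eq_mul]
    refine le_mul_of_one_le_left hF.le ((one_le_inv₀ hq).2 ?_)
    exact Real.sqrt_le_one.2 h1

end Pure

/-! ### Operator bounds for product vectors. -/

section Kronecker
variable {n m n' m' : Type*} [Fintype n] [Fintype m] [Fintype n'] [Fintype m']
  [DecidableEq n] [DecidableEq n']

theorem kronecker_mul_conjTranspose_le {K : Matrix n m ℂ} {L : Matrix n' m' ℂ} {α β : ℝ}
    (hα : 0 ≤ α) (hK : K * Kᴴ ≤ α • (1 : Matrix n n ℂ)) (hL : L * Lᴴ ≤ β • (1 : Matrix n' n' ℂ)) :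
    (K ⊗ₖ L) * (K ⊗ₖ L)ᴴ ≤ (α * β) • (1 : Matrix (n × n') (n × n') ℂ) := by
  rw [Matrix.le_iff] at hK hL ⊢
  have h1 := hK.kronecker (posSemidef_self_mul_conjTranspose L)
  have h2 := (PosSemidef.one (n := n) (R := ℂ)).kronecker hL |>.smul hα
  -- `αβ - KKᴴ ⊗ LLᴴ = (α - KKᴴ) ⊗ LLᴴ + α (1 ⊗ (β - LLᴴ))`.
  convert h1.add h2 using 1
  rw [conjTranspose_kronecker, ← mul_kronecker_mul, ← one_kronecker_one]
  ext ⟨i, i'⟩ ⟨j, j'⟩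
  simp only [Matrix.sub_apply, Matrix.add_apply, Matrix.smul_apply, kronecker_apply, Complex.real_smul,
    Complex.ofReal_mul]
  ring

end Kronecker

/-! ### Pulling an operator bound back through Bob's isometry. -/

section Pullback
variable {q b t : Type*} [Fintype q] [Fintype t]

/-- Partial trace over the outer factors of three. -/
def trOuter (M : Matrix (q × b × t) (q × b × t) ℂ) : Matrix b b ℂ :=
  ∑ x : q × t, M.submatrix (fun i => (x.1, i, x.2)) (fun i => (x.1, i, x.2))

theorem trOuter_mono {M N : Matrix (q × b × t) (q × b × t) ℂ} (h : M ≤ N) :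
    trOuter M ≤ trOuter N :=
  Finset.sum_le_sum fun x _ => by
    rw [Matrix.le_iff] at h ⊢
    exact h.submatrix _

theorem trOuter_smul_one [DecidableEq q] [DecidableEq b] [DecidableEq t] (κ : ℝ) :
    trOuter (κ • (1 : Matrix (q × b × t) (q × b × t) ℂ)) =
      (κ * (Fintype.card q * Fintype.card t)) • (1 : Matrix b b ℂ) := by
  ext i j
  simp only [trOuter, Matrix.sum_apply, submatrix_apply, Matrix.smul_apply, Matrix.one_apply, Prod.mk.injEq]
  by_cases h : i = j
  · simp [h, mul_comm]
  · simp [h]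

variable [Fintype b]

theorem trace_trOuter (M : Matrix (q × b × t) (q × b × t) ℂ) : (trOuter M).trace = M.trace := by
  simp only [trOuter, Matrix.trace, diag_apply, Matrix.sum_apply, submatrix_apply]
  rw [Finset.sum_comm]
  simp only [Fintype.sum_prod_type]
  exact Finset.sum_congr rfl fun x _ => Finset.sum_comm

/-- A purification of `trOuter (N * Nᴴ)`. -/
def outerToPurifying {j : Type*} (N : Matrix (q × b × t) j ℂ) : Matrix b ((q × t) × j) ℂ :=
  of fun i x => N (x.1.1, i, x.1.2) x.2

omit [Fintype b] in
theorem outerToPurifying_mul {j : Type*} [Fintype j] (M N : Matrix (q × b × t) j ℂ) :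
    outerToPurifying M * (outerToPurifying N)ᴴ = trOuter (M * Nᴴ) := by
  ext i k
  simp only [trOuter, outerToPurifying, Matrix.sum_apply, submatrix_apply, Matrix.mul_apply,
    conjTranspose_apply, of_apply]
  rw [Fintype.sum_prod_type]

variable [DecidableEq q] [DecidableEq b] [DecidableEq t]

/-- Pulling a vector back along an isometry. -/
theorem exists_substate_of_isometry {e j : Type*} [Fintype e] [Fintype j] [DecidableEq e]
    {V : Matrix e (q × b × t) ℂ} (hV : Vᴴ * V = 1)
    (v : Matrix (q × b × t) j ℂ) {c : Matrix e j ℂ} {κ : ℝ}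
    (hκ : c * cᴴ ≤ κ • (1 : Matrix e e ℂ)) (hc : (c * cᴴ).trace.re ≤ 1) :
    ∃ σ : Matrix b b ℂ, IsSubstate σ ∧
      σ ≤ (κ * (Fintype.card q * Fintype.card t)) • (1 : Matrix b b ℂ) ∧
      (V * v * cᴴ).trace.re ≤ fidelity (trOuter (v * vᴴ)) σ := by
  have hVV : V * Vᴴ ≤ 1 := by
    have := conjTranspose_mul_self_le_one (C := Vᴴ) (by rw [conjTranspose_conjTranspose, hV])
    rwa [conjTranspose_conjTranspose] at this
  -- For the pulled-back vector `Vᴴ * c`, `V * Vᴴ ≤ 1` controls the trace and `Vᴴ * V = 1` keeps the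
  -- bound `κ`; its overlap with `v` equals that of `c` with `V * v`.
  refine ⟨trOuter ((Vᴴ * c) * (Vᴴ * c)ᴴ), ⟨?_, ?_⟩, ?_, ?_⟩
  · rw [← outerToPurifying_mul]
    exact posSemidef_self_mul_conjTranspose _
  · rw [trace_trOuter, trace_mul_comm, conjTranspose_mul, conjTranspose_conjTranspose]
    have := trace_re_mono (conj_mono hVV cᴴ)
    rw [conjTranspose_conjTranspose, Matrix.mul_one, trace_mul_comm cᴴ c] at this
    simp only [Matrix.mul_assoc] at this ⊢
    exact this.trans hc
  · rw [← trOuter_smul_one]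
    refine trOuter_mono ?_
    have := conj_mono hκ Vᴴ
    rw [conjTranspose_conjTranspose, Matrix.mul_smul, Matrix.mul_one, Matrix.smul_mul, hV] at this
    rw [conjTranspose_mul, conjTranspose_conjTranspose]
    simpa only [Matrix.mul_assoc] using this
  · have := re_trace_le_fidelity (outerToPurifying v) (outerToPurifying (Vᴴ * c))
    rw [outerToPurifying_mul, outerToPurifying_mul, outerToPurifying_mul, trace_trOuter,
      conjTranspose_mul, conjTranspose_conjTranspose, ← Matrix.mul_assoc, trace_mul_comm,
      ← Matrix.mul_assoc] at this
    rwa [conjTranspose_mul, conjTranspose_conjTranspose]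

end Pullback

/-! ### Partial traces and maximally entangled states. -/

section Traces
variable {n m : Type*} [Fintype n] [Fintype m]

theorem trace_trFst (M : Matrix (n × m) (n × m) ℂ) : (trFst M).trace = M.trace := by
  simp only [trFst, Matrix.trace, diag_apply, Fintype.sum_prod_type_right]

theorem trace_trSnd (M : Matrix (n × m) (n × m) ℂ) : (trSnd M).trace = M.trace := by
  simp only [trSnd, Matrix.trace, diag_apply, Fintype.sum_prod_type]

theorem IsState.trFst {ρ : Matrix (n × m) (n × m) ℂ} (hρ : IsState ρ) : IsState (trFst ρ) := by
  refine ⟨?_, by rw [trace_trFst, hρ.2]⟩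
  have := posSemidef_sum Finset.univ fun (a : n) _ => hρ.1.submatrix fun i : m => (a, i)
  convert this using 1
  ext i j
  simp [QSR.trFst, Matrix.sum_apply]

theorem IsState.trSnd {ρ : Matrix (n × m) (n × m) ℂ} (hρ : IsState ρ) : IsState (trSnd ρ) := by
  refine ⟨?_, by rw [trace_trSnd, hρ.2]⟩
  have := posSemidef_sum Finset.univ fun (c : m) _ => hρ.1.submatrix fun i : n => (i, c)
  convert this using 1
  ext i j
  simp [QSR.trSnd, Matrix.sum_apply]

theorem trace_submatrix_equiv {A : Matrix n n ℂ} (e : m ≃ n) :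
    (A.submatrix e e).trace = A.trace := by
  simp only [Matrix.trace, diag_apply, submatrix_apply]
  exact e.sum_comp fun i => A i i

omit [Fintype n] [Fintype m] in
theorem pureState_kronecker (ψ : n → ℂ) (φ : m → ℂ) :
    pureState ψ ⊗ₖ pureState φ = pureState fun i : n × m => ψ i.1 * φ i.2 := by
  ext ⟨i, i'⟩ ⟨j, j'⟩
  simp only [pureState, kronecker_apply, vecMulVec_apply, Pi.star_apply, star_mul']
  ring

/-- No-signalling: trace preservation, applied to each block, makes the channel invisible once its
output is discarded. -/
theorem IsChannel.trFst_localOp {Φ : Matrix n n ℂ →ₗ[ℂ] Matrix m m ℂ} (hΦ : IsChannel Φ)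
    {r : Type*} (M : Matrix (n × r) (n × r) ℂ) : trFst (localOp Φ M) = trFst M := by
  ext i j
  exact hΦ.2 fun x y => M (x, i) (y, j)

theorem trace_maxEntangled {k : ℕ} (hk : 0 < k) : (maxEntangled k).trace = 1 := by
  have hk' : (k : ℝ) ≠ 0 := by positivity
  have h : ∀ i : Fin k × Fin k, maxEntangled k i i = if i.1 = i.2 then (((k : ℝ)⁻¹ : ℝ) : ℂ) else 0 := by
    intro i
    simp only [maxEntangled, pureState, vecMulVec_apply, Pi.star_apply]
    split_ifs
    · rw [Complex.star_def, Complex.conj_ofReal, ← Complex.ofReal_mul, ← sq, div_pow,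
        Real.sq_sqrt (Nat.cast_nonneg _)]
      simp
    · simp
  simp only [Matrix.trace, diag_apply, h, Fintype.sum_prod_type, Finset.sum_ite_eq,
    Finset.mem_univ, if_true, Finset.sum_const, Finset.card_univ, Fintype.card_fin]
  rw [nsmul_eq_mul, ← Complex.ofReal_natCast, ← Complex.ofReal_mul, mul_inv_cancel₀ hk',
    Complex.ofReal_one]

end Traces

/-! ### Regrouping tensor factors of purifications. -/

section Regroup
variable {X z g E F y : Type*}

/-- Regroup the tensor factors of a vector on `z ⊗ E ⊗ g ⊗ F` with `X = z ⊗ g`. -/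
def regroup (e : X ≃ z × g) (N : Matrix (z × E) (g × F) ℂ) : Matrix X (E × F) ℂ :=
  of fun i k => N ((e i).1, k.1) ((e i).2, k.2)

theorem trace_regroup [Fintype X] [Fintype z] [Fintype g] [Fintype E] [Fintype F]
    (e : X ≃ z × g) (M N : Matrix (z × E) (g × F) ℂ) :
    (regroup e M * (regroup e N)ᴴ).trace = (M * Nᴴ).trace := by
  simp only [Matrix.trace, diag_apply, Matrix.mul_apply, conjTranspose_apply]
  rw [← Fintype.sum_prod_type', ← Fintype.sum_prod_type']
  refine Fintype.sum_equiv ((e.prodCongr (Equiv.refl _)).trans (Equiv.prodProdProdComm _ _ _ _))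
    _ _ fun x => ?_
  rfl

/-- If `S` purifies the input with `F`, the dilation `V` acting on it purifies the output with `E ⊗
F`. -/
theorem localOp_mul_conjTranspose [Fintype y] [Fintype E] [Fintype F]
    {Φ : Matrix y y ℂ →ₗ[ℂ] Matrix z z ℂ} {V : Matrix (z × E) y ℂ}
    (hV : ∀ M, Φ M = trSnd (V * M * Vᴴ)) (S : Matrix (y × g) F ℂ) (e : X ≃ z × g) :
    (localOp Φ (S * Sᴴ)).submatrix e e =
      regroup e (V * of fun a (x : g × F) => S (a, x.1) x.2) *
        (regroup e (V * of fun a (x : g × F) => S (a, x.1) x.2))ᴴ := by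
  ext i j
  let v (h : g) : Matrix y F ℂ := of fun a f => S (a, h) f
  have h1 : (fun x x' => (S * Sᴴ) (x, (e i).2) (x', (e j).2)) = v (e i).2 * (v (e j).2)ᴴ := by
    ext x x'
    simp [v, Matrix.mul_apply]
  rw [submatrix_apply, localOp, h1, hV,
    show V * (v (e i).2 * (v (e j).2)ᴴ) * Vᴴ = (V * v (e i).2) * (V * v (e j).2)ᴴ by
      rw [conjTranspose_mul]; simp only [Matrix.mul_assoc]]
  simp only [trSnd]
  rw [Matrix.mul_apply, Fintype.sum_prod_type]
  refine Finset.sum_congr rfl fun k _ => ?_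
  rw [Matrix.mul_apply]
  rfl

end Regroup

/-! ### The protocol: smoothing on `BC` yields smoothing on `B`. -/

namespace Protocol
variable {A B C R : Type*} [Fintype A] [Fintype B] [Fintype C] [Fintype R]

/-- The state before Bob's operation, with his systems first. -/
def bobInput (P : Protocol A B C) (ψ : A × B × C × R → ℂ) :
    Matrix ((Fin P.dQ × B × Fin P.kIn) × A × Fin P.kOut × R)
      ((Fin P.dQ × B × Fin P.kIn) × A × Fin P.kOut × R) ℂ :=
  (P.afterEnc (pureState ψ ⊗ₖ maxEntangled P.kIn)).submatrix
    (fun ((q, b, t), a, s, r) => ((a, s, q), b, t, r))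
    (fun ((q, b, t), a, s, r) => ((a, s, q), b, t, r))

/-- The grouping of the systems of the output into those touched by Bob and the others. -/
def outEquiv (A B C R : Type*) (k : ℕ) :
    (A × B × C × R) × Fin k × Fin k ≃ (B × C × Fin k) × A × Fin k × R where
  toFun := fun ((a, b, c, r), s, t) => ((b, c, t), a, s, r)
  invFun := fun ((b, c, t), a, s, r) => ((a, b, c, r), s, t)
  left_inv _ := rfl
  right_inv _ := rfl

omit [Fintype R] in
theorem output_eq (P : Protocol A B C) (ψ : A × B × C × R → ℂ) :
    P.output (pureState ψ ⊗ₖ maxEntangled P.kIn) =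
      (localOp P.dec (P.bobInput ψ)).submatrix (outEquiv A B C R P.kOut)
        (outEquiv A B C R P.kOut) := rfl

theorem posSemidef_bobInput (P : Protocol A B C) (ψ : A × B × C × R → ℂ) :
    (P.bobInput ψ).PosSemidef := by
  refine PosSemidef.submatrix (P.enc_channel.posSemidef_localOp (PosSemidef.submatrix ?_ _)) _
  rw [maxEntangled, pureState_kronecker]
  exact posSemidef_vecMulVec_self_star _

/-- Alice's outputs, including `Q`, are all traced out, so no-signalling removes her channel; the
remaining ebit contributes its trace, one. -/
theorem trOuter_trSnd_bobInput (P : Protocol A B C) (ψ : A × B × C × R → ℂ)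
    {ρ : Matrix (A × B × C) (A × B × C) ℂ} (hψ : IsPurification ψ ρ) :
    trOuter (trSnd (P.bobInput ψ)) = trSnd (trFst ρ) := by
  ext b b'
  have h1 : trOuter (trSnd (P.bobInput ψ)) b b' =
      ∑ x : Fin P.kIn × R, trFst (P.afterEnc (pureState ψ ⊗ₖ maxEntangled P.kIn))
        (b, x.1, x.2) (b', x.1, x.2) := by
    simp only [trOuter, trSnd, trFst, Matrix.sum_apply, submatrix_apply, bobInput]
    rw [← Fintype.sum_prod_type', ← Fintype.sum_prod_type']
    exact Fintype.sum_equiv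
      ⟨fun ((q, t), a, s, r) => ((t, r), a, s, q), fun ((t, r), a, s, q) => ((q, t), a, s, r),
        fun _ => rfl, fun _ => rfl⟩ _ _ fun _ => rfl
  rw [h1, afterEnc, P.enc_channel.trFst_localOp]
  have h2 : trSnd (trFst ρ) b b' =
      ∑ x : A × C × R, pureState ψ (x.1, b, x.2.1, x.2.2) (x.1, b', x.2.1, x.2.2) := by
    subst hψ
    simp only [trSnd, trFst, submatrix_apply, Fintype.sum_prod_type]
    exact Finset.sum_comm
  rw [h2, ← mul_one (∑ x : A × C × R, _), ← trace_maxEntangled P.kIn_pos, Matrix.trace,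
    Finset.sum_mul_sum]
  simp only [trFst, submatrix_apply, kronecker_apply]
  rw [← Fintype.sum_prod_type', ← Fintype.sum_prod_type']
  exact Fintype.sum_equiv
    ⟨fun ((t, r), a, c, s) => ((a, c, r), s, t), fun ((a, c, r), s, t) => ((t, r), a, c, s),
      fun _ => rfl, fun _ => rfl⟩ _ _ fun _ => rfl

variable [DecidableEq A] [DecidableEq B] [DecidableEq C] [DecidableEq R]

/-- The grouping of a vector on Bob's output systems and environment `E`. -/
def bobEquiv (B C S E : Type*) : (B × C × S) × E ≃ (B × C) × S × E :=
  ⟨fun ((b, c, s), e) => ((b, c), s, e), fun ((b, c), s, e) => ((b, c, s), e),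
    fun _ => rfl, fun _ => rfl⟩

/-- The grouping of a vector on Alice's output systems, the reference and an environment `F`. -/
def aliceEquiv (A R S F : Type*) : (A × S × R) × F ≃ (A × R) × S × F :=
  ⟨fun ((a, s, r), f) => ((a, r), s, f), fun ((a, r), s, f) => ((a, s, r), f),
    fun _ => rfl, fun _ => rfl⟩

/-- From a smoothing of `ρ` on `BC` to a smoothing of `ρ` on `B`. -/
theorem exists_mem_ball (P : Protocol A B C) {ψ : A × B × C × R → ℂ}
    {ρ : Matrix (A × B × C) (A × B × C) ℂ} (hρ : IsState ρ) (hψ : IsPurification ψ ρ)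
    {ε₁ ε₂ : ℝ} (hε₁ : ε₁ ∈ Set.Ioo (0 : ℝ) 1) (hε₂ : ε₂ ∈ Set.Ioo (0 : ℝ) (1 - ε₁))
    (hP : P.IsRedistribution ψ ε₁) {τ : Matrix (B × C) (B × C) ℂ}
    (hτ : τ ∈ ball ε₂ (trFst ρ)) {κ : ℝ} (hκ : 0 ≤ κ)
    (hτκ : τ ≤ κ • (1 : Matrix (B × C) (B × C) ℂ)) :
    ∃ σ ∈ ball (ε₁ + ε₂) (trSnd (trFst ρ)),
      σ ≤ (κ * (P.kOut : ℝ)⁻¹ * (P.dQ * P.kIn)) • (1 : Matrix B B ℂ) := by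
  have hk : (0 : ℝ) < P.kOut := Nat.cast_pos.2 P.kOut_pos
  -- the state `ρ` and its marginals
  let Ψ₀ : Matrix (B × C) (A × R) ℂ := of fun i k => ψ (k.1, i.1, i.2, k.2)
  have hBC : trFst ρ = Ψ₀ * Ψ₀ᴴ := by
    subst hψ
    ext i j
    simp only [trFst, trSnd, Matrix.mul_apply, Fintype.sum_prod_type]
    rfl
  have htBC : (trFst ρ).trace.re = 1 := by rw [trace_trFst, hρ.2, Complex.one_re]
  have htB : (trSnd (trFst ρ)).trace.re = 1 := by rw [trace_trSnd, htBC]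
  have htψ : (pureState ψ).trace = 1 := by
    rw [← hρ.2, ← hψ, trace_trSnd]
    simp only [Matrix.trace, diag_apply, submatrix_apply]
    exact Fintype.sum_equiv ⟨fun (a, b, c, r) => ((a, b, c), r), fun ((a, b, c), r) => (a, b, c, r),
      fun _ => rfl, fun _ => rfl⟩ _ _ fun _ => rfl
  -- the target state
  let mv : Fin P.kOut × Fin P.kOut → ℂ := fun i =>
    if i.1 = i.2 then ((1 / Real.sqrt P.kOut : ℝ) : ℂ) else 0
  let φ : (A × B × C × R) × Fin P.kOut × Fin P.kOut → ℂ := fun i => ψ i.1 * mv i.2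
  have hφ : pureState ψ ⊗ₖ maxEntangled P.kOut = pureState φ := pureState_kronecker ψ mv
  have htφ : (pureState φ).trace = 1 := by
    rw [← hφ, trace_kronecker, htψ, trace_maxEntangled P.kOut_pos, one_mul]
  -- dilation of the output
  obtain ⟨V, hV, hdec⟩ := P.dec_channel.exists_isometry
  set S := CFC.sqrt (P.bobInput ψ) with hS
  have hSS : S * Sᴴ = P.bobInput ψ := by
    rw [hS, sqrt_conjTranspose, sqrt_mul_sqrt (P.posSemidef_bobInput ψ)]
  let v : Matrix (Fin P.dQ × B × Fin P.kIn) ((A × Fin P.kOut × R) × _) ℂ :=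
    of fun a x => S (a, x.1) x.2
  have hvv : v * vᴴ = trSnd (P.bobInput ψ) := by
    rw [← hSS]
    ext i j
    simp only [trSnd, Matrix.mul_apply, Fintype.sum_prod_type, v]
    rfl
  let e := outEquiv A B C R P.kOut
  have hout : P.output (pureState ψ ⊗ₖ maxEntangled P.kIn) =
      regroup e (V * v) * (regroup e (V * v))ᴴ := by
    rw [output_eq, ← hSS]
    exact localOp_mul_conjTranspose hdec S e
  have hF := sq_fidelity_of_purifiedDist_le hε₁.1.le (.inr (by rw [hφ, htφ, Complex.one_re])) hP
  rw [hout, hφ] at hF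
  have hF0 : 0 < fidelity (regroup e (V * v) * (regroup e (V * v))ᴴ) (pureState φ) := by
    refine (fidelity_nonneg _ _).lt_of_ne fun h => ?_
    rw [← h] at hF
    nlinarith [hε₁.1, hε₁.2]
  -- `w` is the ideal state of Bob's environment `E` together with the purifying system `F`.
  obtain ⟨w, hw, hwF⟩ := exists_product_overlap _ htφ hF0
  -- the smoothed state
  obtain ⟨χ, hχτ, hχ⟩ := exists_uhlmann Ψ₀ hτ.1.1
  rw [← hBC] at hχ
  have hF2 := sq_fidelity_of_purifiedDist_le hε₂.1.le (.inl htBC) hτ.2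
  -- `D` is the vector of `Φ₂` and `Ω` is `w`, as matrices. `extend N` is the product of `N` with
  -- both, across the cut between Bob's outputs with `E` and the remaining systems.
  let D : Matrix (Fin P.kOut) (Fin P.kOut) ℂ := ((1 / Real.sqrt P.kOut : ℝ)) • 1
  let Ω : Matrix ((B × C × Fin P.kOut) × (Fin P.dQ × B × Fin P.kIn))
    ((Fin P.dQ × B × Fin P.kIn) × A × Fin P.kOut × R) ℂ := of fun i j => w (i, j)
  let extend (N : Matrix (B × C) (A × R) ℂ) := (N ⊗ₖ (D ⊗ₖ Ω)).submatrix (bobEquiv B C _ _)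
    (aliceEquiv A R _ _)
  have hDD : D * Dᴴ = ((P.kOut : ℝ)⁻¹) • (1 : Matrix (Fin P.kOut) (Fin P.kOut) ℂ) := by
    simp only [D, conjTranspose_smul, conjTranspose_one, star_trivial, Matrix.mul_smul,
      Matrix.mul_one, smul_smul]
    rw [← sq, div_pow, Real.sq_sqrt hk.le, one_pow, one_div]
  have hΩ : (Ω * Ωᴴ).trace.re = 1 := by
    rw [trace_mul_conjTranspose_re, ← hw, trace_pureState_re, ← Fintype.sum_prod_type']
    refine Finset.sum_congr rfl fun i _ => ?_
    rw [Complex.star_def, Complex.mul_conj, Complex.ofReal_re, Complex.normSq_eq_norm_sq]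
    rfl
  have hΩ1 : Ω * Ωᴴ ≤ (1 : ℝ) • 1 := by
    rw [← hΩ]
    exact le_trace_smul_one (posSemidef_self_mul_conjTranspose Ω)
  have hΩc : (Ω * Ωᴴ).trace = 1 := by
    have := (Complex.le_def.1 (posSemidef_self_mul_conjTranspose Ω).trace_nonneg).2
    exact Complex.ext hΩ this.symm
  have h_extend (M N : Matrix (B × C) (A × R) ℂ) : extend M * (extend N)ᴴ =
      ((M ⊗ₖ (D ⊗ₖ Ω)) * (N ⊗ₖ (D ⊗ₖ Ω))ᴴ).submatrix (bobEquiv B C _ _) (bobEquiv B C _ _) := by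
    simp only [extend]
    rw [conjTranspose_submatrix, submatrix_mul_equiv]
  have h_trace (M N : Matrix (B × C) (A × R) ℂ) :
      (extend M * (extend N)ᴴ).trace = (M * Nᴴ).trace := by
    rw [h_extend, trace_submatrix_equiv, conjTranspose_kronecker, conjTranspose_kronecker,
      ← mul_kronecker_mul, ← mul_kronecker_mul, trace_kronecker, trace_kronecker, hΩc, hDD,
      trace_smul, trace_one, Fintype.card_fin, Complex.real_smul, ← Complex.ofReal_natCast,
      ← Complex.ofReal_mul, inv_mul_cancel₀ hk.ne', Complex.ofReal_one, mul_one, mul_one]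
  have hprod : vecMulVec φ w = regroup e (extend Ψ₀) := by
    ext ⟨⟨a, b, c, r⟩, s, t⟩ ⟨i, j⟩
    simp [regroup, extend, e, outEquiv, bobEquiv, aliceEquiv, vecMulVec_apply, φ, mv, Ψ₀, D, Ω,
      Matrix.one_apply, eq_comm, mul_assoc]
  have hχ1 : (χ * χᴴ).trace.re ≤ 1 := (trace_re_mono hχτ).trans hτ.1.2
  -- The marginal of `χ` contributes `κ`, that of `Φ₂` is `1 / kOut`, and that of the unit vector
  -- `w` is at most one.
  have hbound : extend χ * (extend χ)ᴴ ≤ (κ * (P.kOut : ℝ)⁻¹) • 1 := by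
    have h1 := kronecker_mul_conjTranspose_le hκ (hχτ.trans hτκ)
      (kronecker_mul_conjTranspose_le (inv_nonneg.2 hk.le) hDD.le hΩ1)
    rw [mul_one, Matrix.le_iff] at h1
    have h2 := h1.submatrix (bobEquiv B C (Fin P.kOut) _)
    rw [h_extend, Matrix.le_iff]
    simpa only [submatrix_sub, submatrix_smul, submatrix_one_equiv, Pi.sub_apply, Pi.smul_apply]
      using h2
  obtain ⟨σ, hσ, hσκ, hσF⟩ := exists_substate_of_isometry hV v hbound
    (by rw [h_trace]; exact hχ1)
  rw [hvv, trOuter_trSnd_bobInput P ψ hψ] at hσF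
  rw [Fintype.card_fin, Fintype.card_fin] at hσκ
  refine ⟨σ, ⟨hσ, ?_⟩, hσκ⟩
  have ha : (regroup e (V * v) * (regroup e (V * v))ᴴ).trace.re ≤ 1 := by
    rw [trace_regroup, conjTranspose_mul, trace_mul_comm, ← Matrix.mul_assoc, Matrix.mul_assoc vᴴ,
      hV, Matrix.mul_one, trace_mul_comm, hvv, ← trace_trOuter, trOuter_trSnd_bobInput P ψ hψ, htB]
  -- The triangle runs from the dilated output through the ideal vector, the only one required to
  -- have unit norm, to the smoothed one.
  have htri := trace_triangle (a := regroup e (V * v)) (b := regroup e (extend Ψ₀))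
    (c := regroup e (extend χ)) ha
    (by rw [trace_regroup, h_trace, ← hBC, htBC]) (by rw [trace_regroup, h_trace]; exact hχ1)
  rw [hprod] at hwF
  rw [trace_regroup e (extend Ψ₀), h_trace, hχ, trace_regroup e _ (extend χ)] at htri
  have hfin := sq_overlap_bound hε₁.1.le hε₂.1.le (by linarith [hε₂.2]) (hF0.le.trans hwF)
    (fidelity_nonneg _ _) (hF.trans (pow_le_pow_left₀ hF0.le hwF 2)) hF2 htri
  exact purifiedDist_le_of_overlap (by linarith [hε₁.1, hε₂.1]) htB hfin.1 hfin.2 hσF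

end Protocol
end QSR
end

/-! ### From operator bounds to the entropy inequality. -/

theorem mainTheorem9
    {A B C R : Type*} [Fintype A] [Fintype B] [Fintype C] [Fintype R]
    [DecidableEq A] [DecidableEq B] [DecidableEq C] [DecidableEq R]
    (ε₁ ε₂ : ℝ) (hε₁ : ε₁ ∈ Set.Ioo (0 : ℝ) 1) (hε₂ : ε₂ ∈ Set.Ioo (0 : ℝ) (1 - ε₁))
    (ρ : Matrix (A × B × C) (A × B × C) ℂ) (hρ : QSR.IsState ρ)
    (ψ : A × B × C × R → ℂ) (hψ : QSR.IsPurification ψ ρ)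
    (P : QSR.Protocol A B C) (hP : P.IsRedistribution ψ ε₁) :
    ∃ h₁ h₂ : ℝ,
      QSR.smoothMinEntropy ε₂ (QSR.trFst ρ) = (h₁ : EReal) ∧
      QSR.smoothMinEntropy (ε₁ + ε₂) (QSR.trSnd (QSR.trFst ρ)) = (h₂ : EReal) ∧
      P.eCost + P.qCost ≥ h₁ - h₂ := by
  have hBC := hρ.trFst
  have hB := hBC.trSnd
  obtain ⟨h₁, hh₁⟩ := QSR.exists_smoothMinEntropy_eq hBC hε₂.1.le (by linarith [hε₁.1, hε₂.2])
  obtain ⟨h₂, hh₂⟩ := QSR.exists_smoothMinEntropy_eq hB (ε := ε₁ + ε₂)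
    (by linarith [hε₁.1, hε₂.1]) (by linarith [hε₂.2])
  refine ⟨h₁, h₂, hh₁, hh₂, ?_⟩
  have hle : QSR.smoothMinEntropy ε₂ (QSR.trFst ρ) ≤ ((P.eCost + P.qCost + h₂ : ℝ) : EReal) := by
    refine iSup₂_le fun τ hτ => QSR.minEntropy_le fun t ht => ?_
    obtain ⟨σ, hσ, hσt⟩ := P.exists_mem_ball hρ hψ hε₁ hε₂ hP hτ (by positivity) ht
    have hkI : (0 : ℝ) < P.kIn := Nat.cast_pos.2 P.kIn_pos
    have hkO : (0 : ℝ) < P.kOut := Nat.cast_pos.2 P.kOut_pos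
    have hdQ : (0 : ℝ) < P.dQ := Nat.cast_pos.2 P.dQ_pos
    -- The dimension factor `dQ * kIn / kOut` is two to the power of the total cost.
    have hpow : (2 : ℝ) ^ t * (P.kOut : ℝ)⁻¹ * (P.dQ * P.kIn) =
        (2 : ℝ) ^ (t + (P.eCost + P.qCost)) := by
      rw [QSR.Protocol.eCost, QSR.Protocol.qCost, Real.rpow_add two_pos, Real.rpow_add two_pos,
        Real.rpow_sub two_pos, Real.rpow_logb two_pos (by norm_num) hkI,
        Real.rpow_logb two_pos (by norm_num) hkO, Real.rpow_logb two_pos (by norm_num) hdQ]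
      field_simp
    rw [hpow] at hσt
    have h1 : ((-(t + (P.eCost + P.qCost)) : ℝ) : EReal) ≤ (h₂ : EReal) :=
      hh₂ ▸ (QSR.le_minEntropy hσt).trans (le_iSup₂_of_le σ hσ le_rfl)
    have := EReal.coe_le_coe_iff.1 h1
    linarith
  rw [hh₁, EReal.coe_le_coe_iff] at hle
  linarith
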